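/- Let $d\in\mathbb N$, $\sigma>0$, $T>0$, and let $\beta:[0,T]\to\mathbb{R}_{>0}$ be a noise schedule, i.e. a continuous, non-decreasing, positive function. Let $\pi_{\rm data}$ be a probability measure on $\mathbb{R}^d$, let $\pi_\infty=\mathcal N(0,\sigma^2 \mathrm I_d)$, and let $(X_t)_{t\in[0,T]}$ be a process with continuous paths solving $$\mathrm dX_t=-\frac{\beta(t)}{2\sigma^2}X_t\,\mathrm dt+\sqrt{\beta(t)}\,\mathrm dB_t,\qquad X_0\sim\pi_{\rm data},$$ where $B$ is a standard $d$-dimensional Brownian motion independent of $X_0$. Denote by $p_T$ the law of $X_T$. Then $$\mathrm{KL}(p_T\,\|\,\pi_\infty)\le \mathrm{KL}(\pi_{\rm data}\,\|\,\pi_\infty)\,\exp\Big(-\frac1{\sigma^2}\int_0^T\beta(s)\,\mathrm ds\Big),$$ where $\mathrm{KL}(\mu\|\nu)=\int\log\frac{\mathrm d\mu}{\mathrm d\nu}\,\mathrm d\mu\in[0,+\infty]$ if $\mu\ll\nu$, and $\mathrm{KL}(\mu\|\nu)=+\infty$ otherwise (so the bound is trivial when the right-hand side is infinite). -/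

import Mathlib

open MeasureTheory ProbabilityTheory
open scoped NNReal ENNReal

/-- A noise schedule on `[0, T]`: a continuous, non-decreasing, positive function of time. -/
structure IsNoiseSchedule (T : ℝ) (β : ℝ → ℝ) : Prop where
  continuousOn : ContinuousOn β (Set.Icc 0 T)
  monotoneOn : MonotoneOn β (Set.Icc 0 T)
  pos : ∀ t ∈ Set.Icc 0 T, 0 < β t

/-- A standard Brownian motion in `ℝ^d`: its coordinates are independent real standard Brownian
motions. -/
structure IsStdBrownianMotion {Ω : Type*} [MeasurableSpace Ω] {d : ℕ}
    (B : ℝ≥0 → Ω → EuclideanSpace ℝ (Fin d)) (P : Measure Ω) : Prop where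
  measurable : ∀ t, Measurable (B t)
  isBrownianReal : ∀ i, IsBrownianReal (fun t ω ↦ B t ω i) P
  indep : iIndepFun (fun i ω (t : ℝ≥0) ↦ B t ω i) P

/-- `∑_{k < n} f(kt/n) (B_{(k+1)t/n} - B_{kt/n})`, the left-point Riemann sum of `∫_0^t f(s) dB_s`
for the uniform partition of `[0, t]` into `n` intervals. -/
noncomputable def wienerSum {Ω : Type*} {d : ℕ} (f : ℝ → ℝ)
    (B : ℝ≥0 → Ω → EuclideanSpace ℝ (Fin d)) (t : ℝ) (n : ℕ) (ω : Ω) :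
    EuclideanSpace ℝ (Fin d) :=
  ∑ k ∈ Finset.range n,
    f (k * t / n) • (B ((k + 1) * t / n).toNNReal ω - B (k * t / n).toNNReal ω)

/-- For a deterministic `f` continuous on `[0, t]`: the random vector `I` is (a version of) the
stochastic integral `∫_0^t f(s) dB_s`, that is, the limit in probability of the left-point Riemann
sums. -/
def IsWienerIntegral {Ω : Type*} [MeasurableSpace Ω] {d : ℕ} (P : Measure Ω) (f : ℝ → ℝ)
    (B : ℝ≥0 → Ω → EuclideanSpace ℝ (Fin d)) (t : ℝ)
    (I : Ω → EuclideanSpace ℝ (Fin d)) : Prop :=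
  TendstoInMeasure P (wienerSum f B t) Filter.atTop I

/-- `X` is, on `[0, T]`, a solution driven by the standard Brownian motion `B` of
`dX_t = - β(t) / (2σ²) X_t dt + √β(t) dB_t` with `X_0 ∼ μ` independent of `B`: its paths are almost
surely continuous and for every `t ∈ [0, T]`
`X_t - X_0 + ∫_0^t β(s) / (2σ²) X_s ds = ∫_0^t √β(s) dB_s` almost surely. -/
structure IsForwardProcess {Ω : Type*} [MeasurableSpace Ω] {d : ℕ} (P : Measure Ω)
    (σ T : ℝ) (β : ℝ → ℝ) (μ : Measure (EuclideanSpace ℝ (Fin d)))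
    (B : ℝ≥0 → Ω → EuclideanSpace ℝ (Fin d)) (X : ℝ → Ω → EuclideanSpace ℝ (Fin d)) : Prop where
  isStdBrownianMotion : IsStdBrownianMotion B P
  measurable : ∀ t ∈ Set.Icc 0 T, Measurable (X t)
  hasLaw_zero : HasLaw (X 0) μ P
  indep : IndepFun (X 0) (fun ω (t : ℝ≥0) ↦ B t ω) P
  continuousOn : ∀ᵐ ω ∂P, ContinuousOn (fun t ↦ X t ω) (Set.Icc 0 T)
  sde : ∀ t ∈ Set.Icc 0 T, IsWienerIntegral P (fun s ↦ √(β s)) B t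
    (fun ω ↦ X t ω - X 0 ω + ∫ s in (0 : ℝ)..t, (β s / (2 * σ ^ 2)) • X s ω)

/-- The centred Gaussian distribution on `ℝ^d` with covariance matrix `σ² I_d`. -/
noncomputable def piInf (d : ℕ) (σ : ℝ) : Measure (EuclideanSpace ℝ (Fin d)) :=
  multivariateGaussian 0 (σ ^ 2 • (1 : Matrix (Fin d) (Fin d) ℝ))

/-!
The proof has two independent halves: the law of `X_T` is identified as the output of a Gaussian
channel, and relative entropy is shown to contract through that channel.

**The law of `X_T`.** Put `g = β / (2σ²)`, `h(t) = exp ∫₀ᵗ g` and `W_t = X_t - X_0 + ∫₀ᵗ g X`.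
Along every continuous path, `h(T) X_T - X_0` is the limit of the sums
`∑ h(t_j) (W_{t_{j+1}} - W_{t_j})` over uniform partitions (`tendsto_sum_exp_integral_smul`); this is
the formula `d(hX) = h dW`, and needs no stochastic calculus. Since each `W_t` is a Wiener integral
of `√β`, the characteristic function of such a sum is explicit
(`charFun_map_add_sum_wienerIntegral`), and in the limit `X_T` has the law of
`a X_0 + √(1 - a²) Z` with `a = 1 / h(T)` and `Z ∼ N(0, σ² I)` independent of `X_0`
(`IsForwardProcess.map_eq_ouLaw`). This law is called `ouLaw σ a μ` below.

**Contraction.** It remains to see that `KL(ouLaw σ a μ ‖ γ) ≤ a² KL(μ ‖ γ)` for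
`γ = N(0, σ² I)`. Write `φ(c) = KL(ouLaw σ √c μ ‖ γ)`. Instead of a logarithmic Sobolev inequality,
the argument uses convexity of `φ`. From the chain rule and the data processing inequality,
relative entropy with respect to a product measure is strongly superadditive
(`klDiv_strong_superadditivity`). Applied to three coordinates of an orthogonal image of
`(X, Z₁, Z₂)`, where `X ∼ μ` and `Z₁, Z₂ ∼ γ` are independent, it gives
`2 φ(1 - y) ≤ φ(1 - 2y) + φ(1)` (`two_mul_klDiv_ouLaw_le`). With the semigroup property
`ouLaw_ouLaw` and `φ(0) = 0`, induction yields `n φ(m / n) ≤ m φ(1)` for `m ≤ n`; monotonicity of `φ`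
(data processing once more) extends `φ(c) ≤ c φ(1)` from rational to real `c`.
-/

open Filter Topology InformationTheory RealInnerProductSpace

/-! ### Relative entropy with respect to a product measure -/

theorem klDiv_prod_left_same {α β : Type*} [MeasurableSpace α] [MeasurableSpace β]
    (μ ν : Measure α) [IsProbabilityMeasure μ] [IsProbabilityMeasure ν]
    (γ : Measure β) [IsProbabilityMeasure γ] :
    klDiv (μ.prod γ) (ν.prod γ) = klDiv μ ν := by
  simpa only [Measure.compProd_const] using klDiv_compProd_left μ ν (Kernel.const α γ)

/-- The chain rule for a product reference measure: the second term is the entropy of the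
conditional law of the second coordinate relative to `γ`. -/
theorem klDiv_prod_right_eq_add {α β : Type*} [MeasurableSpace α] [MeasurableSpace β]
    [StandardBorelSpace β] [Nonempty β] (ν : Measure (α × β)) [IsProbabilityMeasure ν]
    (ρ : Measure α) [IsProbabilityMeasure ρ] (γ : Measure β) [IsProbabilityMeasure γ] :
    klDiv ν (ρ.prod γ) = klDiv ν.fst ρ + klDiv ν (ν.fst.prod γ) := by
  have h := klDiv_compProd_eq_add ν.fst ρ ν.condKernel (Kernel.const α γ)
  simpa only [ν.disintegrate ν.condKernel, Measure.compProd_const] using h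

/-- Strong superadditivity: if the last coordinate of the reference measure is independent of the
others, the relative entropies `H` of the marginals of `ν` on the coordinates `ABC`, `AB`, `BC`, `B`
satisfy `H(BC) + H(AB) ≤ H(B) + H(ABC)`. By the chain rule this says that the relative entropy of
`ν` with respect to `ν_AB ⊗ γ` does not increase when the first coordinate is forgotten. -/
theorem klDiv_strong_superadditivity {α β δ : Type*} [MeasurableSpace α] [MeasurableSpace β]
    [MeasurableSpace δ] [StandardBorelSpace δ] [Nonempty δ]
    (ν : Measure ((α × β) × δ)) [IsProbabilityMeasure ν]
    (ρ : Measure (α × β)) [IsProbabilityMeasure ρ] (γ : Measure δ) [IsProbabilityMeasure γ] :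
    klDiv (ν.map fun p ↦ (p.1.2, p.2)) (ρ.snd.prod γ) + klDiv ν.fst ρ ≤
      klDiv (ν.map fun p ↦ p.1.2) ρ.snd + klDiv ν (ρ.prod γ) := by
  have hf : Measurable fun p : (α × β) × δ ↦ (p.1.2, p.2) := by fun_prop
  have := Measure.isProbabilityMeasure_map (μ := ν) hf.aemeasurable
  have hfst : (ν.map fun p ↦ (p.1.2, p.2)).fst = ν.map fun p ↦ p.1.2 :=
    Measure.fst_map_prodMk (by fun_prop)
  have hle := klDiv_map_le ν (ν.fst.prod γ) hf
  have hmap : (ν.fst.prod γ).map (fun p ↦ (p.1.2, p.2)) = (ν.map fun p ↦ p.1.2).prod γ := by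
    have h := Measure.map_prod_map ν.fst γ (f := Prod.snd) (g := id) measurable_snd measurable_id
    rw [Measure.map_id, Measure.fst, Measure.map_map measurable_snd measurable_fst] at h
    exact h.symm
  rw [hmap] at hle
  rw [klDiv_prod_right_eq_add ν, klDiv_prod_right_eq_add (ν.map fun p ↦ (p.1.2, p.2)), hfst,
    add_comm (klDiv ν.fst ρ), ← add_assoc]
  gcongr

/-! ### The Gaussian channel -/

section Channel

variable {d : ℕ} {σ : ℝ}

instance : IsGaussian (piInf d σ) := by unfold piInf; infer_instance

theorem charFun_piInf (t : EuclideanSpace ℝ (Fin d)) :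
    charFun (piInf d σ) t = Complex.exp (-(σ ^ 2 * ‖t‖ ^ 2 / 2 : ℝ)) := by
  have hS : (σ ^ 2 • (1 : Matrix (Fin d) (Fin d) ℝ)).PosSemidef :=
    Matrix.PosSemidef.one.smul (sq_nonneg σ)
  rw [piInf, charFun_multivariateGaussian hS]
  congr 1
  have h : t.ofLp ⬝ᵥ (σ ^ 2 • (1 : Matrix (Fin d) (Fin d) ℝ)).mulVec t.ofLp =
      σ ^ 2 * ‖t‖ ^ 2 := by
    rw [Matrix.smul_mulVec, Matrix.one_mulVec, dotProduct_smul, EuclideanSpace.real_norm_sq_eq]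
    simp [dotProduct, pow_two]
  rw [h]
  simp

theorem map_rotation_prod_piInf {a b : ℝ} (h : a ^ 2 + b ^ 2 = 1) :
    ((piInf d σ).prod (piInf d σ)).map (fun p ↦ (a • p.1 + b • p.2, -b • p.1 + a • p.2)) =
      (piInf d σ).prod (piInf d σ) := by
  obtain ⟨θ, ha, hb⟩ : ∃ θ, Real.cos θ = a ∧ Real.sin θ = b := by
    have hn : ‖(⟨a, b⟩ : ℂ)‖ = 1 := by
      rw [Complex.norm_def, Complex.normSq_mk, ← pow_two, ← pow_two, h, Real.sqrt_one]
    refine ⟨Complex.arg ⟨a, b⟩, ?_, ?_⟩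
    · rw [Complex.cos_arg (norm_pos_iff.mp (hn ▸ one_pos)), hn, div_one]
    · rw [Complex.sin_arg, hn, div_one]
  have h0 : (piInf d σ)[id] = 0 := by simp [piInf]
  have := IsGaussian.map_rotation_eq_self h0 θ
  subst ha hb
  exact this

theorem map_linComb_prod_piInf {a b : ℝ} (h : a ^ 2 + b ^ 2 = 1) :
    ((piInf d σ).prod (piInf d σ)).map (fun p ↦ a • p.1 + b • p.2) = piInf d σ := by
  have := congrArg Measure.fst (map_rotation_prod_piInf (d := d) (σ := σ) h)
  rwa [Measure.fst_map_prodMk (by fun_prop), Measure.fst_prod] at this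

variable (σ) in
/-- The law of `a X + √(1 - a²) Z`, where `X` has law `μ` and `Z`, with law `N(0, σ² I)`, is
independent of `X`. This is meant for `a² ≤ 1`; otherwise the coefficient of `Z` is zero. -/
noncomputable def ouLaw (a : ℝ) (μ : Measure (EuclideanSpace ℝ (Fin d))) :
    Measure (EuclideanSpace ℝ (Fin d)) :=
  (μ.prod (piInf d σ)).map fun p ↦ a • p.1 + √(1 - a ^ 2) • p.2

instance (a : ℝ) (μ : Measure (EuclideanSpace ℝ (Fin d))) [IsProbabilityMeasure μ] :
    IsProbabilityMeasure (ouLaw σ a μ) :=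
  Measure.isProbabilityMeasure_map (by fun_prop)

theorem charFun_map_linComb_prod (μ ν : Measure (EuclideanSpace ℝ (Fin d)))
    [IsProbabilityMeasure μ] [IsProbabilityMeasure ν] (a b : ℝ) (t : EuclideanSpace ℝ (Fin d)) :
    charFun ((μ.prod ν).map fun p ↦ a • p.1 + b • p.2) t =
      charFun μ (a • t) * charFun ν (b • t) := by
  have := Measure.isProbabilityMeasure_map (μ := μ) (f := (a • ·)) (by fun_prop)
  have := Measure.isProbabilityMeasure_map (μ := ν) (f := (b • ·)) (by fun_prop)
  have h := Measure.map_prod_map μ ν (f := (a • ·)) (g := (b • ·)) (by fun_prop) (by fun_prop)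
  have h2 := charFun_map_add_prod_eq_mul (μ := μ.map (a • ·)) (ν := ν.map (b • ·))
  rw [h, Measure.map_map (by fun_prop) (by fun_prop)] at h2
  rw [← charFun_map_smul, ← charFun_map_smul, ← Pi.mul_apply, ← h2]
  rfl

theorem charFun_ouLaw {a : ℝ} (ha : a ^ 2 ≤ 1) (μ : Measure (EuclideanSpace ℝ (Fin d)))
    [IsProbabilityMeasure μ] (t : EuclideanSpace ℝ (Fin d)) :
    charFun (ouLaw σ a μ) t =
      charFun μ (a • t) * Complex.exp (-(σ ^ 2 * (1 - a ^ 2) * ‖t‖ ^ 2 / 2 : ℝ)) := by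
  rw [ouLaw, charFun_map_linComb_prod, charFun_piInf, norm_smul, mul_pow, Real.norm_eq_abs, sq_abs,
    Real.sq_sqrt (by linarith), mul_assoc (σ ^ 2)]

/-- If `X ∼ μ` and two copies of `N(0, σ² I)` are independent, a combination with unit coefficient
vector `(a, b, c)` depends in law only on the coefficient `a` of `X`. -/
theorem map_linComb_prod_prod_piInf (μ : Measure (EuclideanSpace ℝ (Fin d)))
    [IsProbabilityMeasure μ] {a b c : ℝ} (h : a ^ 2 + b ^ 2 + c ^ 2 = 1) :
    ((μ.prod (piInf d σ)).prod (piInf d σ)).map (fun p ↦ a • p.1.1 + b • p.1.2 + c • p.2) =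
      ouLaw σ a μ := by
  have := Measure.isProbabilityMeasure_map (μ := μ.prod (piInf d σ))
    (f := fun p ↦ a • p.1 + b • p.2) (by fun_prop)
  have hmap : ((μ.prod (piInf d σ)).prod (piInf d σ)).map
      (fun p ↦ a • p.1.1 + b • p.1.2 + c • p.2) =
      (((μ.prod (piInf d σ)).map fun p ↦ a • p.1 + b • p.2).prod (piInf d σ)).map
        fun p ↦ (1 : ℝ) • p.1 + c • p.2 := by
    have h := Measure.map_prod_map (μ.prod (piInf d σ)) (piInf d σ)
      (f := fun p ↦ a • p.1 + b • p.2) (g := id) (by fun_prop) (by fun_prop)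
    rw [Measure.map_id] at h
    rw [h, Measure.map_map (by fun_prop) (by fun_prop)]
    simp [Function.comp_def]
  have := Measure.isProbabilityMeasure_map (μ := (μ.prod (piInf d σ)).prod (piInf d σ))
    (f := fun p ↦ a • p.1.1 + b • p.1.2 + c • p.2) (by fun_prop)
  refine Measure.ext_of_charFun (funext fun t ↦ ?_)
  rw [hmap, charFun_map_linComb_prod, charFun_map_linComb_prod, charFun_piInf, charFun_piInf,
    charFun_ouLaw (by nlinarith), one_smul, mul_assoc, ← Complex.exp_add, norm_smul, norm_smul]
  congr 2
  norm_cast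
  rw [mul_pow, mul_pow, Real.norm_eq_abs, Real.norm_eq_abs, sq_abs, sq_abs,
    show 1 - a ^ 2 = b ^ 2 + c ^ 2 by linarith]
  ring

theorem ouLaw_ouLaw {a b : ℝ} (ha : a ^ 2 ≤ 1) (hb : b ^ 2 ≤ 1)
    (μ : Measure (EuclideanSpace ℝ (Fin d))) [IsProbabilityMeasure μ] :
    ouLaw σ a (ouLaw σ b μ) = ouLaw σ (a * b) μ := by
  refine Measure.ext_of_charFun (funext fun t ↦ ?_)
  rw [charFun_ouLaw ha, charFun_ouLaw hb, charFun_ouLaw (by nlinarith [sq_nonneg a, sq_nonneg b]),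
    mul_assoc, ← Complex.exp_add, norm_smul, smul_smul, mul_comm b a]
  congr 2
  norm_cast
  rw [mul_pow, Real.norm_eq_abs, sq_abs]
  ring

theorem ouLaw_zero (μ : Measure (EuclideanSpace ℝ (Fin d))) [IsProbabilityMeasure μ] :
    ouLaw σ 0 μ = piInf d σ := by
  refine Measure.ext_of_charFun (funext fun t ↦ ?_)
  rw [charFun_ouLaw (by simp), charFun_piInf]
  simp

/-- Data processing: the channel preserves `N(0, σ² I)`, so it does not increase the relative
entropy. -/
theorem klDiv_ouLaw_le {a : ℝ} (ha : a ^ 2 ≤ 1) (μ : Measure (EuclideanSpace ℝ (Fin d)))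
    [IsProbabilityMeasure μ] : klDiv (ouLaw σ a μ) (piInf d σ) ≤ klDiv μ (piInf d σ) := by
  have h := klDiv_map_le (μ.prod (piInf d σ)) ((piInf d σ).prod (piInf d σ))
    (g := fun p ↦ a • p.1 + √(1 - a ^ 2) • p.2) (by fun_prop)
  rwa [map_linComb_prod_piInf (by rw [Real.sq_sqrt (by linarith)]; ring),
    klDiv_prod_left_same] at h

/-- Convexity at the end point: with `φ(c) = KL(ouLaw σ √c μ ‖ N(0, σ² I))` and `y = q²`, so that
`p² = 1 - y` and `(a p)² = 1 - 2y`, this is `2 φ(1 - y) ≤ φ(1 - 2y) + φ(1)`. -/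
theorem two_mul_klDiv_ouLaw_le {p q a b : ℝ} (hpq : p ^ 2 + q ^ 2 = 1) (hab : a ^ 2 + b ^ 2 = 1)
    (hbp : b * p = q) (μ : Measure (EuclideanSpace ℝ (Fin d))) [IsProbabilityMeasure μ] :
    2 * klDiv (ouLaw σ p μ) (piInf d σ) ≤
      klDiv (ouLaw σ (a * p) μ) (piInf d σ) + klDiv μ (piInf d σ) := by
  set γ := piInf d σ with hγ
  -- `(X, Z₁, Z₂)` is mapped to `(A, B, C)`: `R₁` gives `P = p X + q Z₁` and `C = -q X + p Z₁`,
  -- then `R₂` gives `A = -b P + a Z₂` and `B = a P + b Z₂`.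
  let E := EuclideanSpace ℝ (Fin d)
  let R₁ : (E × E) × E → (E × E) × E :=
    fun z ↦ ((p • z.1.1 + q • z.1.2, -q • z.1.1 + p • z.1.2), z.2)
  let S : (E × E) × E → (E × E) × E := fun z ↦ ((z.1.1, z.2), z.1.2)
  let R₂ : (E × E) × E → (E × E) × E :=
    fun z ↦ ((-b • z.1.1 + a • z.1.2, a • z.1.1 + b • z.1.2), z.2)
  have hR₁ : ((γ.prod γ).prod γ).map R₁ = (γ.prod γ).prod γ := by
    have h := Measure.map_prod_map (γ.prod γ) γ
      (f := fun z ↦ (p • z.1 + q • z.2, -q • z.1 + p • z.2)) (g := id) (by fun_prop) (by fun_prop)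
    rw [Measure.map_id, hγ, map_rotation_prod_piInf hpq] at h
    exact h.symm
  have hR₂ : ((γ.prod γ).prod γ).map R₂ = (γ.prod γ).prod γ := by
    have h := Measure.map_prod_map (γ.prod γ) γ
      (f := fun z ↦ (-b • z.1 + a • z.2, a • z.1 + b • z.2)) (g := id) (by fun_prop) (by fun_prop)
    have h' : (γ.prod γ).map (fun z ↦ (-b • z.1 + a • z.2, a • z.1 + b • z.2)) = γ.prod γ := by
      have := congrArg (Measure.map Prod.swap) (map_rotation_prod_piInf (d := d) (σ := σ) hab)
      rw [Measure.map_map (by fun_prop) (by fun_prop), Measure.prod_swap] at this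
      exact this
    rw [Measure.map_id, h'] at h
    exact h.symm
  have hS : ((γ.prod γ).prod γ).map S = (γ.prod γ).prod γ := by
    have h := (measurePreserving_prodAssoc γ γ γ).symm.comp
      (((MeasurePreserving.id γ).prod Measure.measurePreserving_swap).comp
        (measurePreserving_prodAssoc γ γ γ))
    exact h.map_eq
  let R := R₂ ∘ S ∘ R₁
  have hRm : Measurable R := by fun_prop
  have hR : ((γ.prod γ).prod γ).map R = (γ.prod γ).prod γ := by
    rw [← Measure.map_map (by fun_prop) (by fun_prop), ← Measure.map_map (by fun_prop)
      (by fun_prop), hR₁, hS, hR₂]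
  let τ := (μ.prod γ).prod γ
  have : IsProbabilityMeasure (τ.map R) := Measure.isProbabilityMeasure_map hRm.aemeasurable
  have key := klDiv_strong_superadditivity (τ.map R) (γ.prod γ) γ
  have h1 : klDiv (τ.map R) ((γ.prod γ).prod γ) ≤ klDiv μ γ := by
    have h := klDiv_map_le τ ((γ.prod γ).prod γ) hRm
    rwa [hR, klDiv_prod_left_same, klDiv_prod_left_same] at h
  have h2 : (τ.map R).map (fun z ↦ z.1.2) = ouLaw σ (a * p) μ := by
    rw [Measure.map_map (by fun_prop) hRm, ← map_linComb_prod_prod_piInf (b := a * q) (c := b) μ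
      (by linear_combination a ^ 2 * hpq + hab)]
    congr 1
    ext z : 1
    simp only [R, R₁, R₂, S, Function.comp_apply]
    module
  -- `P = -b A + a B` is recovered from `(A, B)`.
  have h3 : klDiv (ouLaw σ p μ) γ ≤ klDiv (τ.map R).fst (γ.prod γ) := by
    have h := klDiv_map_le (τ.map R).fst (γ.prod γ) (g := fun z ↦ -b • z.1 + a • z.2)
      (by fun_prop)
    rw [hγ, map_linComb_prod_piInf (by linear_combination hab), Measure.fst,
      Measure.map_map (by fun_prop) (by fun_prop), Measure.map_map (by fun_prop) hRm] at h
    rw [← map_linComb_prod_prod_piInf (b := q) (c := 0) μ (by linear_combination hpq)]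
    refine le_of_eq_of_le (congrArg (klDiv · γ) ?_) h
    congr 1
    ext z : 1
    simp only [R, R₁, R₂, S, Function.comp_apply]
    match_scalars
    · linear_combination -p * hab
    · linear_combination -q * hab
    · ring
  -- `a B - b C` also has coefficient `p` along `X`, because `b p = q`.
  have h4 : klDiv (ouLaw σ p μ) γ ≤ klDiv ((τ.map R).map fun z ↦ (z.1.2, z.2)) (γ.prod γ) := by
    have h := klDiv_map_le ((τ.map R).map fun z ↦ (z.1.2, z.2)) (γ.prod γ)
      (g := fun z ↦ a • z.1 + -b • z.2) (by fun_prop)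
    rw [hγ, map_linComb_prod_piInf (by linear_combination hab),
      Measure.map_map (by fun_prop) (by fun_prop), Measure.map_map (by fun_prop) hRm] at h
    rw [← map_linComb_prod_prod_piInf (b := -b ^ 2 * q) (c := a * b) μ (by
      have h1 : p ^ 2 + b ^ 2 * p ^ 2 = 1 := by rw [← mul_pow, hbp, hpq]
      rw [← hbp]
      linear_combination (1 - b ^ 2 + b ^ 4) * h1 + b ^ 2 * hab)]
    refine le_of_eq_of_le (congrArg (klDiv · γ) ?_) h
    congr 1
    ext z : 1
    simp only [R, R₁, R₂, S, Function.comp_apply]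
    match_scalars
    · linear_combination -p * hab + b * hbp
    · linear_combination -q * hab + hbp
    · ring
  rw [Measure.snd_prod] at key
  rw [h2] at key
  calc _ = _ + _ := two_mul _
    _ ≤ _ := add_le_add h4 h3
    _ ≤ _ := key
    _ ≤ _ := by gcongr

end Channel

/-! ### Contraction of relative entropy through the Gaussian channel -/

section Contraction

variable {d : ℕ} {σ : ℝ}

/-- The bound `φ(c) ≤ c φ(1)` for `c = k / (k + 1)`. In the induction step the convexity inequality
with `y = 1 / (k + 2)` is combined with the induction hypothesis for the measure `ouLaw σ √((k + 1)
/ (k + 2)) μ`, whose image under the channel with `c = k / (k + 1)` corresponds to `c = k / (k + 2)`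
for `μ`. -/
theorem klDiv_ouLaw_sqrt_succ_le (k : ℕ) (μ : Measure (EuclideanSpace ℝ (Fin d)))
    [IsProbabilityMeasure μ] :
    (k + 1) * klDiv (ouLaw σ √(k / (k + 1)) μ) (piInf d σ) ≤ k * klDiv μ (piInf d σ) := by
  induction k generalizing μ with
  | zero => simp [ouLaw_zero]
  | succ k ih =>
    have hk : (0 : ℝ) < k + 1 := by positivity
    by_cases htop : klDiv μ (piInf d σ) = ∞
    · rw [htop, ENNReal.mul_top (by simp)]
      exact le_top
    set p : ℝ := √((k + 1 : ℕ) / ((k + 1 : ℕ) + 1)) with hp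
    set a : ℝ := √(k / (k + 1)) with ha
    have hp2 : p ^ 2 = (k + 1) / (k + 2) := by
      rw [hp, Real.sq_sqrt (by positivity)]; push_cast; ring
    have ha2 : a ^ 2 = k / (k + 1) := by rw [ha, Real.sq_sqrt (by positivity)]
    have hp0 : p ^ 2 ≤ 1 := by rw [hp2, div_le_one (by positivity)]; linarith
    have ha0 : a ^ 2 ≤ 1 := by rw [ha2, div_le_one (by positivity)]; linarith
    have hb : √(1 - a ^ 2) * p = √(1 - p ^ 2) := by
      rw [hp, ← Real.sqrt_mul (by linarith), ← hp]
      congr 1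
      rw [ha2, hp2]; push_cast; field_simp; ring
    have key := two_mul_klDiv_ouLaw_le (σ := σ) (p := p) (a := a)
      (by rw [Real.sq_sqrt (sub_nonneg.mpr hp0)]; ring)
      (by rw [Real.sq_sqrt (sub_nonneg.mpr ha0)]; ring) hb μ
    have h := ih (ouLaw σ p μ)
    rw [ouLaw_ouLaw ha0 hp0] at h
    have h1 : klDiv (ouLaw σ p μ) (piInf d σ) ≠ ∞ := ne_top_of_le_ne_top htop (klDiv_ouLaw_le hp0 μ)
    have hap0 : (a * p) ^ 2 ≤ 1 := by rw [mul_pow]; nlinarith [sq_nonneg a, sq_nonneg p]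
    have h2 : klDiv (ouLaw σ (a * p) μ) (piInf d σ) ≠ ∞ :=
      ne_top_of_le_ne_top htop (klDiv_ouLaw_le hap0 μ)
    lift klDiv μ (piInf d σ) to ℝ≥0 using htop with z
    lift klDiv (ouLaw σ p μ) (piInf d σ) to ℝ≥0 using h1 with y
    lift klDiv (ouLaw σ (a * p) μ) (piInf d σ) to ℝ≥0 using h2 with x
    norm_cast at key h ⊢
    rw [← NNReal.coe_le_coe] at key h ⊢
    push_cast at key h ⊢
    nlinarith

theorem klDiv_ouLaw_sqrt_div_le {m n : ℕ} (hmn : m ≤ n)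
    (μ : Measure (EuclideanSpace ℝ (Fin d))) [IsProbabilityMeasure μ] :
    n * klDiv (ouLaw σ √(m / n) μ) (piInf d σ) ≤ m * klDiv μ (piInf d σ) := by
  rcases Nat.eq_zero_or_pos m with rfl | hm
  · simp [ouLaw_zero]
  induction n, hmn using Nat.le_induction generalizing μ with
  | base =>
    gcongr
    exact klDiv_ouLaw_le (by rw [div_self (by positivity)]; simp) μ
  | succ n hmn ih =>
    have hn : (0 : ℝ) < n := by exact_mod_cast hm.trans_le hmn
    have hmn' : (m : ℝ) ≤ n := by exact_mod_cast hmn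
    have h := ih (ouLaw σ √(n / (n + 1)) μ)
    rw [ouLaw_ouLaw (by rw [Real.sq_sqrt (by positivity), div_le_one hn]; exact hmn')
      (by rw [Real.sq_sqrt (by positivity), div_le_one (by positivity)]; linarith),
      ← Real.sqrt_mul (by positivity), div_mul_div_cancel₀ hn.ne'] at h
    have h' := klDiv_ouLaw_sqrt_succ_le (σ := σ) n μ
    have hn0 : (n : ℝ≥0∞) ≠ 0 := by exact_mod_cast hn.ne'
    rw [← ENNReal.mul_le_mul_iff_right hn0 (ENNReal.natCast_ne_top n)]
    push_cast
    calc (n : ℝ≥0∞) * ((n + 1) * klDiv (ouLaw σ √(m / (n + 1)) μ) (piInf d σ))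
        = (n + 1) * (n * klDiv (ouLaw σ √(m / (n + 1)) μ) (piInf d σ)) := by ring
      _ ≤ (n + 1) * (m * klDiv (ouLaw σ √(n / (n + 1)) μ) (piInf d σ)) := by gcongr
      _ = m * ((n + 1) * klDiv (ouLaw σ √(n / (n + 1)) μ) (piInf d σ)) := by ring
      _ ≤ m * (n * klDiv μ (piInf d σ)) := by gcongr
      _ = n * (m * klDiv μ (piInf d σ)) := by ring

/-- The strong data processing inequality for the Gaussian channel with Gaussian reference measure.
It is equivalent to exponential decay of relative entropy along the Ornstein-Uhlenbeck semigroup. -/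
theorem klDiv_ouLaw_le_sq_mul {a : ℝ} (ha0 : 0 ≤ a) (ha : a ≤ 1)
    (μ : Measure (EuclideanSpace ℝ (Fin d))) [IsProbabilityMeasure μ] :
    klDiv (ouLaw σ a μ) (piInf d σ) ≤ ENNReal.ofReal (a ^ 2) * klDiv μ (piInf d σ) := by
  rcases ha0.eq_or_lt with rfl | ha0
  · simp [ouLaw_zero]
  by_cases htop : klDiv μ (piInf d σ) = ∞
  · rw [htop, ENNReal.mul_top (by simpa using ha0.ne')]
    exact le_top
  have hlim : Tendsto (fun n : ℕ ↦ ENNReal.ofReal (a ^ 2 + 1 / (n + 1)) * klDiv μ (piInf d σ)) atTop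
      (𝓝 (ENNReal.ofReal (a ^ 2) * klDiv μ (piInf d σ))) := by
    refine ENNReal.Tendsto.mul_const (ENNReal.tendsto_ofReal ?_) (Or.inr htop)
    simpa using tendsto_one_div_add_atTop_nhds_zero_nat.const_add (a ^ 2)
  refine ge_of_tendsto' hlim fun n ↦ ?_
  have hn : (0 : ℝ) < n + 1 := by positivity
  -- `m / (n + 1)` is the least multiple of `1 / (n + 1)` that is at least `a²`.
  set m := ⌈a ^ 2 * (n + 1)⌉₊ with hm
  have hmn : m ≤ n + 1 := by
    rw [hm, Nat.ceil_le]; push_cast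
    exact mul_le_of_le_one_left hn.le (pow_le_one₀ ha0.le ha)
  have hmn' : (m : ℝ) ≤ n + 1 := by exact_mod_cast hmn
  have hle : a ^ 2 ≤ m / (n + 1) := by
    rw [le_div_iff₀ hn]; exact Nat.le_ceil _
  have hlt : (m : ℝ) / (n + 1) ≤ a ^ 2 + 1 / (n + 1) := by
    rw [div_le_iff₀ hn, add_mul, one_div_mul_cancel hn.ne']
    exact (Nat.ceil_lt_add_one (by positivity)).le
  have hs : 0 < √((m : ℝ) / (n + 1)) := Real.sqrt_pos.mpr ((by positivity : 0 < a ^ 2).trans_le hle)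
  have h1 : klDiv (ouLaw σ a μ) (piInf d σ) ≤ klDiv (ouLaw σ √(m / (n + 1)) μ) (piInf d σ) := by
    have hq : (a / √((m : ℝ) / (n + 1))) ^ 2 ≤ 1 := by
      rw [div_pow, Real.sq_sqrt (by positivity)]
      exact div_le_one_of_le₀ hle (by positivity)
    have h := klDiv_ouLaw_le (σ := σ) hq (ouLaw σ √(m / (n + 1)) μ)
    rwa [ouLaw_ouLaw hq (by rw [Real.sq_sqrt (by positivity), div_le_one hn]; exact hmn'),
      div_mul_cancel₀ _ hs.ne'] at h
  have h2 := klDiv_ouLaw_sqrt_div_le (σ := σ) hmn μ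
  push_cast at h2
  calc klDiv (ouLaw σ a μ) (piInf d σ)
      ≤ klDiv (ouLaw σ √(m / (n + 1)) μ) (piInf d σ) := h1
    _ ≤ ENNReal.ofReal (m / (n + 1)) * klDiv μ (piInf d σ) := by
      have hn1 : ENNReal.ofReal ((n : ℝ) + 1) = (n : ℝ≥0∞) + 1 := by
        exact_mod_cast ENNReal.ofReal_natCast (n + 1)
      rw [ENNReal.ofReal_div_of_pos hn, ENNReal.ofReal_natCast, hn1, mul_comm, ← mul_div_assoc,
        ENNReal.le_div_iff_mul_le (by simp) (by simp), mul_comm, mul_comm (klDiv μ _)]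
      exact h2
    _ ≤ ENNReal.ofReal (a ^ 2 + 1 / (n + 1)) * klDiv μ (piInf d σ) := by gcongr
end Contraction

/-! ### Riemann sums along uniform partitions -/

/-- An error term of the form `∑ ∫ Φ(r, s, u) dr`, over the intervals `[s, u]` of a uniform
partition, tends to zero if `Φ` is continuous and vanishes on the diagonal. -/
theorem tendsto_sum_integral_uniformPartition {F : Type*} [NormedAddCommGroup F] [NormedSpace ℝ F]
    {a b : ℝ} (hab : a ≤ b) (Φ : ℝ × ℝ × ℝ → F) (hΦ : Continuous Φ) (h0 : ∀ s, Φ (s, s, s) = 0) :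
    Tendsto (fun n : ℕ ↦ ∑ k ∈ Finset.range n, ∫ r in (a + k * (b - a) / n)..
      (a + (k + 1) * (b - a) / n), Φ (r, a + k * (b - a) / n, a + (k + 1) * (b - a) / n))
      atTop (𝓝 0) := by
  rw [Metric.tendsto_atTop]
  intro ε hε
  have hba : 0 < b - a + 1 := by linarith
  have huc := (isCompact_Icc (a := (a, a, a)) (b := (b, b, b))).uniformContinuousOn_of_continuous
    hΦ.continuousOn
  obtain ⟨δ, hδ, hΦδ⟩ := Metric.uniformContinuousOn_iff.mp huc (ε / (b - a + 1)) (by positivity)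
  obtain ⟨N, hN⟩ := exists_nat_gt ((b - a) / δ)
  refine ⟨N + 1, fun n hn ↦ ?_⟩
  have hn0 : (0 : ℝ) < n := by exact_mod_cast (Nat.succ_pos N).trans_le hn
  have hstep : (b - a) / n < δ := by
    have : (N : ℝ) < n := by exact_mod_cast hn
    rw [div_lt_iff₀ hn0]
    rw [div_lt_iff₀ hδ] at hN
    nlinarith
  rw [dist_zero_right]
  have hterm : ∀ k ∈ Finset.range n, ‖∫ r in (a + k * (b - a) / n)..(a + (k + 1) * (b - a) / n),
      Φ (r, a + k * (b - a) / n, a + (k + 1) * (b - a) / n)‖ ≤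
        ε / (b - a + 1) * ((b - a) / n) := by
    intro k hk
    have hk' : (k : ℝ) + 1 ≤ n := by exact_mod_cast Finset.mem_range.mp hk
    have hs : a ≤ a + k * (b - a) / n := by
      have : 0 ≤ k * (b - a) / n := by have := sub_nonneg.mpr hab; positivity
      linarith
    have hdiff : a + (k + 1) * (b - a) / n - (a + k * (b - a) / n) = (b - a) / n := by ring
    have hnn : 0 ≤ (b - a) / n := div_nonneg (by linarith) hn0.le
    have hsu : a + k * (b - a) / n ≤ a + (k + 1) * (b - a) / n := by linarith
    have hu : a + (k + 1) * (b - a) / n ≤ b := by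
      have : (k + 1) * (b - a) / n ≤ b - a := by
        rw [div_le_iff₀ hn0, mul_comm]
        exact mul_le_mul_of_nonneg_left hk' (by linarith)
      linarith
    set s := a + k * (b - a) / n
    set u := a + (k + 1) * (b - a) / n
    have h := intervalIntegral.norm_integral_le_of_norm_le_const (a := s) (b := u)
      (f := fun r ↦ Φ (r, s, u)) (C := ε / (b - a + 1)) fun r hr ↦ by
        rw [Set.uIoc_of_le hsu] at hr
        have := hΦδ (r, s, u) ⟨⟨by linarith [hr.1], hs, hs.trans hsu⟩,
            ⟨hr.2.trans hu, hsu.trans hu, hu⟩⟩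
          (s, s, s) ⟨⟨hs, hs, hs⟩, ⟨hsu.trans hu, hsu.trans hu, hsu.trans hu⟩⟩ (by
            simp only [Prod.dist_eq, Real.dist_eq, sub_self, abs_zero]
            rw [abs_of_pos (by linarith [hr.1]), abs_of_nonneg (by linarith)]
            refine max_lt ?_ (max_lt hδ ?_) <;> linarith [hr.2])
        rw [h0, dist_zero_right] at this
        exact this.le
    rwa [hdiff, abs_of_nonneg hnn] at h
  calc _ ≤ ∑ k ∈ Finset.range n, ε / (b - a + 1) * ((b - a) / n) := norm_sum_le_of_le _ hterm
    _ = ε * ((b - a) / (b - a + 1)) := by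
      rw [Finset.sum_const, Finset.card_range, nsmul_eq_mul]; field_simp
    _ < ε := by
      refine mul_lt_of_lt_one_right hε ?_
      rw [div_lt_one hba]; linarith

theorem sum_integral_uniformPartition {F : Type*} [NormedAddCommGroup F] [NormedSpace ℝ F]
    {a b : ℝ} {f : ℝ → F} (hf : Continuous f) {n : ℕ} (hn : n ≠ 0) :
    ∑ k ∈ Finset.range n, ∫ r in (a + k * (b - a) / n)..(a + (k + 1) * (b - a) / n), f r =
      ∫ r in a..b, f r := by
  have h := intervalIntegral.sum_integral_adjacent_intervals (μ := volume) (f := f)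
    (a := fun k : ℕ ↦ a + k * (b - a) / n) (n := n) fun k _ ↦ hf.intervalIntegrable _ _
  have hn' : (n : ℝ) ≠ 0 := by exact_mod_cast hn
  push_cast at h
  rw [h]
  congr 1
  · simp
  · field_simp; ring

theorem tendsto_sum_mul_integral_uniformPartition {a b : ℝ} (hab : a ≤ b) {g f : ℝ → ℝ}
    (hg : Continuous g) (hf : Continuous f) :
    Tendsto (fun n : ℕ ↦ ∑ k ∈ Finset.range n, g (a + k * (b - a) / n) *
      ∫ r in (a + k * (b - a) / n)..(a + (k + 1) * (b - a) / n), f r)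
      atTop (𝓝 (∫ r in a..b, g r * f r)) := by
  have h := tendsto_sum_integral_uniformPartition hab
    (fun p ↦ g p.2.1 * f p.1 - g p.1 * f p.1) (by fun_prop) (by simp)
  have h' := h.add_const (∫ r in a..b, g r * f r)
  rw [zero_add] at h'
  refine h'.congr' ?_
  filter_upwards [eventually_ne_atTop 0] with n hn
  rw [← sum_integral_uniformPartition (show Continuous fun r ↦ g r * f r by fun_prop) hn, ← Finset.sum_add_distrib]
  refine Finset.sum_congr rfl fun k _ ↦ ?_
  rw [← intervalIntegral.integral_add, ← intervalIntegral.integral_const_mul]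
  · simp
  · exact Continuous.intervalIntegrable (by fun_prop) _ _
  · exact Continuous.intervalIntegrable (by fun_prop) _ _

theorem tendsto_riemannSum_uniformPartition {a b : ℝ} (hab : a ≤ b) {g : ℝ → ℝ}
    (hg : Continuous g) :
    Tendsto (fun n : ℕ ↦ ∑ k ∈ Finset.range n, g (a + k * (b - a) / n) * ((b - a) / n))
      atTop (𝓝 (∫ r in a..b, g r)) := by
  have h := tendsto_sum_mul_integral_uniformPartition hab hg (continuous_const (y := (1 : ℝ)))
  simp only [mul_one] at h
  refine h.congr fun n ↦ Finset.sum_congr rfl fun k _ ↦ ?_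
  rw [intervalIntegral.integral_const, smul_eq_mul, mul_one]
  ring

/-! ### The integrating factor along a path -/

theorem hasDerivAt_exp_integral {g : ℝ → ℝ} (hg : Continuous g) (t : ℝ) :
    HasDerivAt (fun t ↦ Real.exp (∫ r in (0 : ℝ)..t, g r))
      (g t * Real.exp (∫ r in (0 : ℝ)..t, g r)) t := by
  rw [mul_comm]
  exact (hg.integral_hasStrictDerivAt 0 t).hasDerivAt.exp

theorem continuous_exp_integral {g : ℝ → ℝ} (hg : Continuous g) :
    Continuous fun t ↦ Real.exp (∫ r in (0 : ℝ)..t, g r) :=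
  continuous_iff_continuousAt.mpr fun t ↦ (hasDerivAt_exp_integral hg t).continuousAt

theorem integral_mul_exp_integral {g : ℝ → ℝ} (hg : Continuous g) (s u : ℝ) :
    ∫ r in s..u, g r * Real.exp (∫ v in (0 : ℝ)..r, g v) =
      Real.exp (∫ r in (0 : ℝ)..u, g r) - Real.exp (∫ r in (0 : ℝ)..s, g r) :=
  intervalIntegral.integral_eq_sub_of_hasDerivAt (fun t _ ↦ hasDerivAt_exp_integral hg t)
    ((hg.mul (continuous_exp_integral hg)).intervalIntegrable _ _)

/-- The formula `d(h x) = h dW` for `h = exp ∫ g`, in the form of a limit of left-point sums, where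
`W` need not have bounded variation. On `[s, u]` the error is `∫ g(r) (h(r) x(u) - h(s) x(r)) dr`.
-/
theorem tendsto_sum_exp_integral_smul_of_continuous {E : Type*} [NormedAddCommGroup E]
    [NormedSpace ℝ E] [CompleteSpace E] {T : ℝ} (hT : 0 ≤ T) {g : ℝ → ℝ} (hg : Continuous g)
    {x W : ℝ → E} (hx : Continuous x)
    (hW : ∀ t, W t = x t - x 0 + ∫ r in (0 : ℝ)..t, g r • x r) :
    Tendsto (fun n : ℕ ↦ ∑ k ∈ Finset.range n, Real.exp (∫ r in (0 : ℝ)..(k * T / n), g r) •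
        (W ((k + 1) * T / n) - W (k * T / n))) atTop
      (𝓝 (Real.exp (∫ r in (0 : ℝ)..T, g r) • x T - x 0)) := by
  set h : ℝ → ℝ := fun t ↦ Real.exp (∫ r in (0 : ℝ)..t, g r) with hh
  have hhc : Continuous h := continuous_exp_integral hg
  have hgx : Continuous fun r ↦ g r • x r := by fun_prop
  have hgh : Continuous fun r ↦ g r * h r := by fun_prop
  have hstep : ∀ s u, h s • (W u - W s) =
      (h u • x u - h s • x s) - ∫ r in s..u, g r • (h r • x u - h s • x r) := by
    intro s u
    have h1 : ∫ r in s..u, g r • (h r • x u - h s • x r) =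
        (h u - h s) • x u - h s • ∫ r in s..u, g r • x r := by
      rw [← integral_mul_exp_integral hg s u, ← intervalIntegral.integral_smul_const,
        ← intervalIntegral.integral_smul, ← intervalIntegral.integral_sub]
      · refine intervalIntegral.integral_congr fun r _ ↦ ?_
        simp only [hh, smul_sub, smul_smul, mul_comm (g r)]
      · exact Continuous.intervalIntegrable (by fun_prop) _ _
      · exact Continuous.intervalIntegrable (by fun_prop) _ _
    have h2 : ∫ r in s..u, g r • x r =
        (∫ r in (0 : ℝ)..u, g r • x r) - ∫ r in (0 : ℝ)..s, g r • x r :=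
      (intervalIntegral.integral_interval_sub_left (hgx.intervalIntegrable _ _)
        (hgx.intervalIntegrable _ _)).symm
    rw [h1, h2, hW, hW]
    module
  have hlim := (tendsto_sum_integral_uniformPartition hT
    (fun p ↦ g p.1 • (h p.1 • x p.2.2 - h p.2.1 • x p.1)) (by fun_prop) (by simp)).const_sub
      (h T • x T - x 0)
  rw [sub_zero (h T • x T - x 0)] at hlim
  refine hlim.congr' ?_
  filter_upwards [eventually_ne_atTop 0] with n hn
  have hn' : (n : ℝ) ≠ 0 := by exact_mod_cast hn
  have htel := Finset.sum_range_sub (fun k : ℕ ↦ h (k * T / n) • x (k * T / n)) n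
  push_cast at htel
  simp only [zero_mul, zero_div, mul_div_cancel_left₀ T hn'] at htel
  have h00 : h 0 = 1 := by simp [hh]
  rw [h00, one_smul] at htel
  rw [Finset.sum_congr rfl fun k _ ↦ hstep _ _, Finset.sum_sub_distrib, htel]
  simp only [zero_add, sub_zero]

/-- The version of `tendsto_sum_exp_integral_smul_of_continuous` for a path that is continuous on
`[0, T]` only. -/
theorem tendsto_sum_exp_integral_smul {E : Type*} [NormedAddCommGroup E]
    [NormedSpace ℝ E] [CompleteSpace E] {T : ℝ} (hT : 0 ≤ T) {g : ℝ → ℝ} (hg : Continuous g)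
    {x W : ℝ → E} (hx : ContinuousOn x (Set.Icc 0 T))
    (hW : ∀ t, W t = x t - x 0 + ∫ r in (0 : ℝ)..t, g r • x r) :
    Tendsto (fun n : ℕ ↦ ∑ k ∈ Finset.range n, Real.exp (∫ r in (0 : ℝ)..(k * T / n), g r) •
        (W ((k + 1) * T / n) - W (k * T / n))) atTop
      (𝓝 (Real.exp (∫ r in (0 : ℝ)..T, g r) • x T - x 0)) := by
  set y : ℝ → E := Set.IccExtend hT ((Set.Icc 0 T).domRestrict x) with hy
  have hyc : Continuous y := (continuousOn_iff_continuous_domRestrict.mp hx).Icc_extend'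
  have hyx : ∀ t ∈ Set.Icc 0 T, y t = x t := fun t ht ↦ by
    rw [hy, Set.IccExtend_of_mem _ _ ht]; rfl
  set V : ℝ → E := fun t ↦ y t - y 0 + ∫ r in (0 : ℝ)..t, g r • y r with hV
  have hVW : ∀ t ∈ Set.Icc 0 T, V t = W t := fun t ht ↦ by
    rw [hW, hV]
    simp only
    rw [hyx t ht, hyx 0 ⟨le_rfl, hT⟩]
    congr 1
    refine intervalIntegral.integral_congr fun r hr ↦ ?_
    rw [Set.uIcc_of_le ht.1] at hr
    simp only [hyx r ⟨hr.1, hr.2.trans ht.2⟩]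
  have := tendsto_sum_exp_integral_smul_of_continuous hT hg hyc (W := V) fun t ↦ rfl
  rw [hyx T ⟨hT, le_rfl⟩, hyx 0 ⟨le_rfl, hT⟩] at this
  refine this.congr fun n ↦ Finset.sum_congr rfl fun k hk ↦ ?_
  have hk' : (k : ℝ) + 1 ≤ n := by exact_mod_cast Finset.mem_range.mp hk
  have hn : (0 : ℝ) < n := by have : (0 : ℝ) ≤ k := k.cast_nonneg; linarith
  rw [hVW, hVW]
  · refine ⟨by positivity, ?_⟩
    rw [div_le_iff₀ hn, mul_comm T]
    gcongr
    exact (Finset.mem_range.mp hk).le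
  · refine ⟨by positivity, ?_⟩
    rw [div_le_iff₀ hn, mul_comm T]
    gcongr

/-! ### Linear combinations of Brownian increments -/

/-- A linear combination of successive increments of a real Brownian motion is centred Gaussian,
with variance `∑ c_k² (s_{k+1} - s_k)`. -/
theorem ProbabilityTheory.IsPreBrownianReal.charFun_map_sum_increments {Ω : Type*}
    [MeasurableSpace Ω] {P : Measure Ω}
    {B : ℝ≥0 → Ω → ℝ} (hB : IsPreBrownianReal B P) {s : ℕ → ℝ≥0} (hs : Monotone s) (c : ℕ → ℝ)
    (n : ℕ) (t : ℝ) :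
    charFun (P.map fun ω ↦ ∑ k ∈ Finset.range n, c k * (B (s (k + 1)) ω - B (s k) ω)) t =
      Complex.exp (-((∑ k ∈ Finset.range n, c k ^ 2 * (s (k + 1) - s k : ℝ)) * t ^ 2 / 2 : ℝ)) := by
  have := hB.isGaussianProcess.isProbabilityMeasure
  have hm : ∀ k, AEMeasurable (fun ω ↦ B (s (k + 1)) ω - B (s k) ω) P := fun k ↦
    (hB.aemeasurable _).sub (hB.aemeasurable _)
  have hind : iIndepFun (fun k ω ↦ c k * (B (s (k + 1)) ω - B (s k) ω)) P :=
    (hB.hasIndepIncrements.nat hs).comp (fun k x ↦ c k * x) fun k ↦ by fun_prop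
  rw [iIndepFun.charFun_map_fun_finsetSum_eq_prod (fun k _ ↦ (hm k).const_mul (c k))
    (hind.restrict _), Finset.prod_apply, Finset.sum_mul, Finset.sum_div,
    ← Complex.ofReal_neg, ← Finset.sum_neg_distrib, Complex.ofReal_sum, Complex.exp_sum]
  refine Finset.prod_congr rfl fun k _ ↦ ?_
  rw [charFun_map_mul_comp (hm k)]
  have hlaw := (hB.hasLaw_sub (s (k + 1)) (s k)).map_eq
  have hd : ((nndist (s (k + 1)).1 (s k).1 : ℝ≥0) : ℝ) = s (k + 1) - s k := by
    rw [coe_nndist, Real.dist_eq, abs_of_nonneg]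
    · rfl
    · exact sub_nonneg.mpr (NNReal.coe_le_coe.mpr (hs k.le_succ))
  rw [show (fun ω ↦ B (s (k + 1)) ω - B (s k) ω) = B (s (k + 1)) - B (s k) from rfl, hlaw,
    charFun_gaussianReal]
  congr 1
  rw [hd]
  push_cast
  ring

theorem IsStdBrownianMotion.charFun_map_sum_increments {Ω : Type*} [MeasurableSpace Ω]
    {P : Measure Ω} [IsProbabilityMeasure P] {d : ℕ} {B : ℝ≥0 → Ω → EuclideanSpace ℝ (Fin d)}
    (hB : IsStdBrownianMotion B P) {s : ℕ → ℝ≥0} (hs : Monotone s) (c : ℕ → ℝ)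
    (n : ℕ) (t : EuclideanSpace ℝ (Fin d)) :
    charFun (P.map fun ω ↦ ∑ k ∈ Finset.range n, c k • (B (s (k + 1)) ω - B (s k) ω)) t =
      Complex.exp
        (-((∑ k ∈ Finset.range n, c k ^ 2 * (s (k + 1) - s k : ℝ)) * ‖t‖ ^ 2 / 2 : ℝ)) := by
  have hm := hB.measurable
  set G : Fin d → Ω → ℝ := fun i ω ↦
    ∑ k ∈ Finset.range n, c k * (B (s (k + 1)) ω i - B (s k) ω i) with hG
  have hGm : ∀ i, Measurable (G i) := fun i ↦ by fun_prop
  have hind : iIndepFun (fun i ω ↦ t i * G i ω) P :=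
    hB.indep.comp (fun i b ↦ t i * ∑ k ∈ Finset.range n, c k * (b (s (k + 1)) - b (s k)))
      fun i ↦ by fun_prop
  have h1 : charFun (P.map fun ω ↦ ∑ k ∈ Finset.range n, c k • (B (s (k + 1)) ω - B (s k) ω)) t =
      charFun (P.map fun ω ↦ ∑ i, t i * G i ω) 1 := by
    rw [charFun_apply, charFun_apply, integral_map (by fun_prop) (by fun_prop),
      integral_map (by fun_prop) (by fun_prop)]
    refine integral_congr_ae (ae_of_all _ fun ω ↦ ?_)
    simp only
    congr 3
    simp [hG, PiLp.inner_apply, Finset.sum_apply]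
  rw [h1, iIndepFun.charFun_map_fun_sum_eq_prod (fun i ↦ ((hGm i).const_mul _).aemeasurable) hind,
    Finset.prod_apply, EuclideanSpace.real_norm_sq_eq, Finset.mul_sum, Finset.sum_div,
    ← Complex.ofReal_neg, ← Finset.sum_neg_distrib, Complex.ofReal_sum, Complex.exp_sum]
  refine Finset.prod_congr rfl fun i _ ↦ ?_
  rw [charFun_map_mul_comp (hGm i).aemeasurable, mul_one, Complex.ofReal_neg]
  exact (hB.isBrownianReal i).toIsPreBrownianReal.charFun_map_sum_increments hs c n (t i)

/-! ### Convergence in measure -/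

theorem MeasureTheory.TendstoInMeasure.add {Ω ι E : Type*} [MeasurableSpace Ω]
    [NormedAddCommGroup E] {P : Measure Ω} {l : Filter ι} {f f' : ι → Ω → E} {g g' : Ω → E}
    (hf : TendstoInMeasure P f l g) (hf' : TendstoInMeasure P f' l g') :
    TendstoInMeasure P (fun i ω ↦ f i ω + f' i ω) l (fun ω ↦ g ω + g' ω) := by
  rw [tendstoInMeasure_iff_norm] at *
  intro ε hε
  have h := (hf (ε / 2) (half_pos hε)).add (hf' (ε / 2) (half_pos hε))
  rw [add_zero] at h
  refine tendsto_of_tendsto_of_tendsto_of_le_of_le tendsto_const_nhds h (fun _ ↦ zero_le) fun i ↦ ?_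
  refine (measure_mono fun ω hω ↦ ?_).trans (measure_union_le _ _)
  by_contra hcon
  simp only [Set.mem_union, Set.mem_ofPred_eq, not_or, not_le] at hcon hω
  have := norm_add_le (f i ω - g ω) (f' i ω - g' ω)
  rw [show f i ω - g ω + (f' i ω - g' ω) = f i ω + f' i ω - (g ω + g' ω) by abel] at this
  linarith [hcon.1, hcon.2]

theorem MeasureTheory.TendstoInMeasure.const_smul {Ω ι E : Type*} [MeasurableSpace Ω]
    [NormedAddCommGroup E] [NormedSpace ℝ E]
    {P : Measure Ω} {l : Filter ι} {f : ι → Ω → E} {g : Ω → E}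
    (hf : TendstoInMeasure P f l g) (c : ℝ) :
    TendstoInMeasure P (fun i ω ↦ c • f i ω) l (fun ω ↦ c • g ω) := by
  rw [tendstoInMeasure_iff_norm] at *
  intro ε hε
  have hc : 0 < |c| + 1 := by positivity
  refine tendsto_of_tendsto_of_tendsto_of_le_of_le tendsto_const_nhds (hf (ε / (|c| + 1))
    (by positivity)) (fun _ ↦ zero_le) fun i ↦ measure_mono fun ω hω ↦ ?_
  simp only [Set.mem_ofPred_eq] at hω ⊢
  rw [← smul_sub, norm_smul, Real.norm_eq_abs] at hω
  rw [div_le_iff₀ hc]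
  nlinarith [norm_nonneg (f i ω - g ω)]

theorem MeasureTheory.tendstoInMeasure_const {Ω ι E : Type*} [MeasurableSpace Ω]
    [PseudoEMetricSpace E] {P : Measure Ω} {l : Filter ι} (g : Ω → E) : TendstoInMeasure P (fun _ : ι ↦ g) l g := by
  intro ε hε
  simp [hε.not_ge, tendsto_const_nhds]

theorem MeasureTheory.TendstoInMeasure.finsetSum {Ω ι κ E : Type*} [MeasurableSpace Ω]
    [NormedAddCommGroup E] {P : Measure Ω} {l : Filter ι} (S : Finset κ)
    {f : κ → ι → Ω → E} {g : κ → Ω → E} (hf : ∀ k ∈ S, TendstoInMeasure P (f k) l (g k)) :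
    TendstoInMeasure P (fun i ω ↦ ∑ k ∈ S, f k i ω) l (fun ω ↦ ∑ k ∈ S, g k ω) := by
  classical
  induction S using Finset.induction_on with
  | empty => simpa using tendstoInMeasure_const _
  | insert a S ha ih =>
    simp only [Finset.sum_insert ha]
    exact TendstoInMeasure.add (hf a (Finset.mem_insert_self a S))
      (ih fun k hk ↦ hf k (Finset.mem_insert_of_mem hk))

theorem tendsto_charFun_map_of_tendstoInMeasure {Ω E : Type*} [MeasurableSpace Ω]
    [NormedAddCommGroup E] [InnerProductSpace ℝ E] [MeasurableSpace E] [BorelSpace E]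
    [SecondCountableTopology E] {P : Measure Ω} [IsProbabilityMeasure P] {f : ℕ → Ω → E} {g : Ω → E}
    (hf : ∀ n, AEMeasurable (f n) P) (h : TendstoInMeasure P f atTop g) (t : E) :
    Tendsto (fun n ↦ charFun (P.map (f n)) t) atTop (𝓝 (charFun (P.map g) t)) := by
  have hg := h.aemeasurable hf
  have key : ∀ {φ : Ω → E}, AEMeasurable φ P →
      charFun (P.map φ) t = ∫ ω, Complex.exp (⟪φ ω, t⟫ * Complex.I) ∂P := fun hφ ↦ by
    rw [charFun_apply, integral_map hφ (by fun_prop)]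
  simp_rw [key hg, fun n ↦ key (hf n)]
  refine tendsto_of_subseq_tendsto fun ns hns ↦ ?_
  obtain ⟨ms, -, hms⟩ := (h.comp hns).exists_seq_tendsto_ae
  refine ⟨ms, tendsto_integral_of_dominated_convergence (fun _ ↦ 1) (fun n ↦ ?_)
    (integrable_const _) (fun n ↦ ae_of_all _ fun ω ↦ ?_) ?_⟩
  · have := hf (ns (ms n))
    exact AEMeasurable.aestronglyMeasurable (by fun_prop)
  · rw [Complex.norm_exp_ofReal_mul_I]
  · filter_upwards [hms] with ω hω
    have hc : Continuous fun x : E ↦ Complex.exp (⟪x, t⟫ * Complex.I) := by fun_prop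
    exact (hc.tendsto _).comp hω

/-! ### Wiener integrals over a uniform partition -/

theorem sum_smul_sum_range_sub {E : Type*} [AddCommGroup E] [Module ℝ E] (c : ℕ → ℝ) (v : ℕ → E)
    (m l : ℕ) :
    ∑ j ∈ Finset.range m,
        c j • (∑ k ∈ Finset.range ((j + 1) * l), v k - ∑ k ∈ Finset.range (j * l), v k) =
      ∑ k ∈ Finset.range (m * l), c (k / l) • v k := by
  induction m with
  | zero => simp
  | succ m ih =>
    rw [Finset.sum_range_succ, ih, Nat.succ_mul, Finset.sum_range_add, Finset.sum_range_add,
      add_sub_cancel_left, Finset.smul_sum]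
    congr 1
    refine Finset.sum_congr rfl fun i hi ↦ ?_
    have hi := Finset.mem_range.mp hi
    rw [mul_comm m l, Nat.mul_add_div (by omega), Nat.div_eq_of_lt hi, add_zero]

theorem mul_grid_div_eq {T : ℝ} {j l : ℕ} (hj : j ≠ 0) (m : ℕ) (x : ℝ) :
    x * (j * T / m) / ((j * l : ℕ) : ℝ) = x * (T / (m * l)) := by
  have hj' : (j : ℝ) ≠ 0 := by exact_mod_cast hj
  push_cast
  rw [show x * (j * T / m) = j * (x * (T / m)) by ring, mul_div_mul_left _ _ hj', mul_div_assoc,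
    div_div]

/-- The partition of `[0, jT/m]` into `j l` intervals has mesh `T / (m l)`, whatever `j` is: the
Riemann sums for different end points live on a common grid. -/
theorem wienerSum_grid {Ω : Type*} {d : ℕ} (f : ℝ → ℝ) (B : ℝ≥0 → Ω → EuclideanSpace ℝ (Fin d))
    (T : ℝ) (j l m : ℕ) (ω : Ω) :
    wienerSum f B (j * T / m) (j * l) ω = ∑ k ∈ Finset.range (j * l), f (k * (T / (m * l))) •
      (B (((k + 1 : ℕ) : ℝ) * (T / (m * l))).toNNReal ω - B (k * (T / (m * l))).toNNReal ω) := by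
  rcases eq_or_ne j 0 with rfl | hj
  · simp [wienerSum]
  refine Finset.sum_congr rfl fun k _ ↦ ?_
  rw [mul_grid_div_eq hj, mul_grid_div_eq hj, Nat.cast_succ]

theorem tendsto_riemannSum_grid {T : ℝ} (hT : 0 ≤ T) {g : ℝ → ℝ} (hg : Continuous g) (j m : ℕ) :
    Tendsto (fun l : ℕ ↦ ∑ k ∈ Finset.range (j * l), g (k * (T / (m * l))) * (T / (m * l))) atTop
      (𝓝 (∫ r in (0 : ℝ)..(j * T / m), g r)) := by
  rcases eq_or_ne j 0 with rfl | hj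
  · simp
  have hlim : Tendsto (fun l ↦ j * l) atTop atTop :=
    tendsto_id.const_mul_atTop' (Nat.pos_of_ne_zero hj)
  refine ((tendsto_riemannSum_uniformPartition (by positivity : 0 ≤ j * T / m) hg).comp
    hlim).congr fun l ↦ Finset.sum_congr rfl fun k _ ↦ ?_
  have h1 := mul_grid_div_eq (T := T) (l := l) hj m 1
  rw [one_mul, one_mul] at h1
  rw [zero_add, sub_zero, mul_grid_div_eq hj, h1]

/-- For `j = 0` the number of intervals does not tend to infinity, but all sums are zero. -/
theorem IsWienerIntegral.tendstoInMeasure_grid {Ω : Type*} [MeasurableSpace Ω] {P : Measure Ω}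
    {d : ℕ} {f : ℝ → ℝ} {B : ℝ≥0 → Ω → EuclideanSpace ℝ (Fin d)} {T : ℝ} {j m : ℕ}
    {I : Ω → EuclideanSpace ℝ (Fin d)} (hI : IsWienerIntegral P f B (j * T / m) I) :
    TendstoInMeasure P (fun l ↦ wienerSum f B (j * T / m) (j * l)) atTop I := by
  rcases eq_or_ne j 0 with rfl | hj
  · have h : ∀ n, wienerSum f B (((0 : ℕ) : ℝ) * T / m) n = 0 := fun n ↦ by
      ext ω; simp [wienerSum]
    unfold IsWienerIntegral at hI
    simp only [h] at hI ⊢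
    rwa [show wienerSum f B (((0 : ℕ) : ℝ) * T / m) = fun _ ↦ 0 from funext h] at hI
  · exact TendstoInMeasure.comp hI (tendsto_id.const_mul_atTop' (Nat.pos_of_ne_zero hj))

theorem measurable_wienerSum {Ω : Type*} [MeasurableSpace Ω] {d : ℕ} (f : ℝ → ℝ)
    {B : ℝ≥0 → Ω → EuclideanSpace ℝ (Fin d)} (hB : ∀ t, Measurable (B t)) (t : ℝ) (n : ℕ) :
    Measurable (wienerSum f B t n) := by
  unfold wienerSum
  fun_prop

/-- If `I t` is the Wiener integral of `f` over `[0, t]` and `Y` is independent of `B`, then `Y`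
plus a linear combination of the increments of `I` over a uniform partition has the characteristic
function of `Y` plus an independent Gaussian vector. The increments are approximated by sums over a
common finer grid. -/
theorem charFun_map_add_sum_wienerIntegral {Ω : Type*} [MeasurableSpace Ω] {P : Measure Ω}
    [IsProbabilityMeasure P] {d : ℕ} {B : ℝ≥0 → Ω → EuclideanSpace ℝ (Fin d)}
    (hB : IsStdBrownianMotion B P) {Y : Ω → EuclideanSpace ℝ (Fin d)} (hY : AEMeasurable Y P)
    (hYB : IndepFun Y (fun ω (t : ℝ≥0) ↦ B t ω) P) {f : ℝ → ℝ} (hf : Continuous f)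
    {T : ℝ} (hT : 0 ≤ T) (I : ℝ → Ω → EuclideanSpace ℝ (Fin d))
    (hI : ∀ t ∈ Set.Icc 0 T, IsWienerIntegral P f B t (I t)) (c : ℕ → ℝ) {m : ℕ}
    (hm : m ≠ 0) (t : EuclideanSpace ℝ (Fin d)) :
    charFun (P.map fun ω ↦ Y ω + ∑ j ∈ Finset.range m,
        c j • (I ((j + 1) * T / m) ω - I (j * T / m) ω)) t =
      charFun (P.map Y) t * Complex.exp (-((∑ j ∈ Finset.range m,
        c j ^ 2 * ∫ r in (j * T / m)..((j + 1) * T / m), f r ^ 2) * ‖t‖ ^ 2 / 2 : ℝ)) := by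
  have hm' : (0 : ℝ) < m := by exact_mod_cast Nat.pos_of_ne_zero hm
  have hBm := hB.measurable
  have hgrid : ∀ j ≤ m, (j : ℝ) * T / m ∈ Set.Icc 0 T := fun j hj ↦ by
    refine ⟨by positivity, ?_⟩
    rw [div_le_iff₀ hm', mul_comm T]
    gcongr
  have hW : ∀ j ≤ m, TendstoInMeasure P (fun l ↦ wienerSum f B (j * T / m) (j * l)) atTop
      (I (j * T / m)) := fun j hj ↦ (hI _ (hgrid j hj)).tendstoInMeasure_grid
  let A : ℕ → Ω → EuclideanSpace ℝ (Fin d) := fun l ω ↦ ∑ j ∈ Finset.range m,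
    c j • (wienerSum f B ((j + 1 : ℕ) * T / m) ((j + 1) * l) ω -
      wienerSum f B (j * T / m) (j * l) ω)
  have hAm : ∀ l, Measurable (A l) := fun l ↦ by
    have := measurable_wienerSum f hBm
    fun_prop
  have hlim : TendstoInMeasure P (fun l ω ↦ Y ω + A l ω) atTop
      (fun ω ↦ Y ω + ∑ j ∈ Finset.range m, c j • (I ((j + 1) * T / m) ω - I (j * T / m) ω)) := by
    refine TendstoInMeasure.add (tendstoInMeasure_const Y)
      (TendstoInMeasure.finsetSum _ fun j hj ↦ ?_)
    have hj := Finset.mem_range.mp hj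
    have h := TendstoInMeasure.add (hW (j + 1) hj)
      (TendstoInMeasure.const_smul (hW j hj.le) (-1))
    simp only [neg_smul, one_smul, ← sub_eq_add_neg] at h
    have h' := TendstoInMeasure.const_smul h (c j)
    push_cast at h' ⊢
    exact h'
  have hcf := tendsto_charFun_map_of_tendstoInMeasure
    (fun l ↦ hY.add (hAm l).aemeasurable) hlim t
  refine tendsto_nhds_unique hcf ?_
  -- On the common grid the approximant is a combination of successive increments of `B`.
  have hval : ∀ l, charFun (P.map fun ω ↦ Y ω + A l ω) t = charFun (P.map Y) t *
      Complex.exp (-((∑ j ∈ Finset.range m, c j ^ 2 *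
        (∑ k ∈ Finset.range ((j + 1) * l), f (k * (T / (m * l))) ^ 2 * (T / (m * l)) -
          ∑ k ∈ Finset.range (j * l), f (k * (T / (m * l))) ^ 2 * (T / (m * l)))) *
            ‖t‖ ^ 2 / 2 : ℝ)) := fun l ↦ by
    set τ : ℝ := T / (m * l) with hτ
    have hτ0 : 0 ≤ τ := by positivity
    set s : ℕ → ℝ≥0 := fun k ↦ ((k : ℝ) * τ).toNNReal with hs
    have hsm : Monotone s := fun a b hab ↦ by
      refine Real.toNNReal_le_toNNReal ?_
      gcongr
    have hsd : ∀ k, (s (k + 1) - s k : ℝ) = τ := fun k ↦ by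
      rw [hs]
      simp only
      rw [Real.coe_toNNReal _ (by positivity), Real.coe_toNNReal _ (by positivity)]
      push_cast; ring
    have hA : A l = fun ω ↦ ∑ k ∈ Finset.range (m * l),
        (c (k / l) * f (k * τ)) • (B (s (k + 1)) ω - B (s k) ω) := by
      ext1 ω
      simp only [A, wienerSum_grid, mul_smul]
      exact sum_smul_sum_range_sub c _ m l
    have hind : IndepFun Y (A l) P := by
      rw [hA]
      exact hYB.comp (φ := id) (ψ := fun b : ℝ≥0 → EuclideanSpace ℝ (Fin d) ↦
        ∑ k ∈ Finset.range (m * l), (c (k / l) * f (k * τ)) • (b (s (k + 1)) - b (s k)))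
        measurable_id (by fun_prop)
    rw [hind.charFun_map_fun_add_eq_mul hY (hAm l).aemeasurable, Pi.mul_apply, hA,
      hB.charFun_map_sum_increments hsm]
    have hvar := sum_smul_sum_range_sub (fun j ↦ c j ^ 2) (fun k : ℕ ↦ f (k * τ) ^ 2 * τ) m l
    simp only [smul_eq_mul] at hvar
    rw [hvar]
    simp only [hsd, mul_pow, mul_assoc]
  refine Tendsto.congr (fun l ↦ (hval l).symm) ?_
  have hvlim : Tendsto (fun l : ℕ ↦ ∑ j ∈ Finset.range m, c j ^ 2 *
        (∑ k ∈ Finset.range ((j + 1) * l), f (k * (T / (m * l))) ^ 2 * (T / (m * l)) -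
          ∑ k ∈ Finset.range (j * l), f (k * (T / (m * l))) ^ 2 * (T / (m * l)))) atTop
      (𝓝 (∑ j ∈ Finset.range m, c j ^ 2 * ∫ r in (j * T / m)..((j + 1) * T / m), f r ^ 2)) := by
    have hf2 : Continuous fun r ↦ f r ^ 2 := by fun_prop
    refine tendsto_finsetSum _ fun j _ ↦ Tendsto.const_mul _ ?_
    rw [← intervalIntegral.integral_interval_sub_left (a := 0) (hf2.intervalIntegrable _ _)
      (hf2.intervalIntegrable _ _)]
    have h1 := tendsto_riemannSum_grid hT hf2 (j + 1) m
    push_cast at h1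
    exact h1.sub (tendsto_riemannSum_grid hT hf2 j m)
  have hcont : Continuous fun v : ℝ ↦
      charFun (P.map Y) t * Complex.exp (-(v * ‖t‖ ^ 2 / 2 : ℝ)) := by fun_prop
  exact (hcont.tendsto _).comp hvlim

/-! ### The law of the forward process -/

/-- The integral of `h² β`, for `h = exp ∫ β / (2σ²)`, is the variance of each coordinate of `∫ h √β
dB`; it is explicit because `(σ² h²)' = h² β`. -/
theorem integral_exp_integral_sq_mul {σ : ℝ} (hσ : 0 < σ) {β : ℝ → ℝ} (hβ : Continuous β) (T : ℝ) :
    ∫ r in (0 : ℝ)..T, Real.exp (∫ v in (0 : ℝ)..r, β v / (2 * σ ^ 2)) ^ 2 * β r =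
      σ ^ 2 * (Real.exp (∫ v in (0 : ℝ)..T, β v / (2 * σ ^ 2)) ^ 2 - 1) := by
  have hg : Continuous fun v ↦ β v / (2 * σ ^ 2) := by fun_prop
  have hh := continuous_exp_integral hg
  rw [intervalIntegral.integral_eq_sub_of_hasDerivAt
    (f := fun t ↦ σ ^ 2 * Real.exp (∫ v in (0 : ℝ)..t, β v / (2 * σ ^ 2)) ^ 2)]
  · simp; ring
  · intro t _
    refine (((hasDerivAt_exp_integral hg t).pow 2).const_mul (σ ^ 2)).congr_deriv ?_
    field_simp
    ring
  · exact Continuous.intervalIntegrable (by fun_prop) _ _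

theorem IsForwardProcess.map_eq_ouLaw_of_continuous {Ω : Type*} [MeasurableSpace Ω] {P : Measure Ω}
    [IsProbabilityMeasure P] {d : ℕ} {σ T : ℝ} (hσ : 0 < σ) (hT : 0 ≤ T) {β : ℝ → ℝ}
    (hβ : Continuous β) (hβ0 : ∀ t, 0 ≤ β t) {μ : Measure (EuclideanSpace ℝ (Fin d))}
    [IsProbabilityMeasure μ]
    {B : ℝ≥0 → Ω → EuclideanSpace ℝ (Fin d)} {X : ℝ → Ω → EuclideanSpace ℝ (Fin d)}
    (hX : IsForwardProcess P σ T β μ B X) :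
    P.map (X T) = ouLaw σ (Real.exp (-∫ r in (0 : ℝ)..T, β r / (2 * σ ^ 2))) μ := by
  set g : ℝ → ℝ := fun r ↦ β r / (2 * σ ^ 2) with hg
  have hgc : Continuous g := by fun_prop
  set h : ℝ → ℝ := fun t ↦ Real.exp (∫ r in (0 : ℝ)..t, g r) with hh
  have hhc : Continuous h := continuous_exp_integral hgc
  have hTT : T ∈ Set.Icc 0 T := ⟨hT, le_rfl⟩
  have hB := hX.isStdBrownianMotion
  let W : ℝ → Ω → EuclideanSpace ℝ (Fin d) := fun t ω ↦
    X t ω - X 0 ω + ∫ r in (0 : ℝ)..t, g r • X r ω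
  have hW : ∀ t ∈ Set.Icc 0 T, IsWienerIntegral P (fun s ↦ √(β s)) B t (W t) := hX.sde
  have hWm : ∀ t ∈ Set.Icc 0 T, AEMeasurable (W t) P := fun t ht ↦
    TendstoInMeasure.aemeasurable
      (fun n ↦ (measurable_wienerSum _ hB.measurable t n).aemeasurable) (hW t ht)
  have hX0 : Measurable (X 0) := hX.measurable 0 ⟨le_rfl, hT⟩
  let M : ℕ → Ω → EuclideanSpace ℝ (Fin d) := fun m ω ↦
    X 0 ω + ∑ j ∈ Finset.range m, h (j * T / m) • (W ((j + 1) * T / m) ω - W (j * T / m) ω)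
  have hMm : ∀ m, AEMeasurable (M m) P := fun m ↦ by
    refine hX0.aemeasurable.add (Finset.aemeasurable_fun_sum _ fun j hj ↦ ?_)
    have hj' : (j : ℝ) + 1 ≤ m := by exact_mod_cast Finset.mem_range.mp hj
    have hm' : (0 : ℝ) < m := by have : (0 : ℝ) ≤ j := j.cast_nonneg; linarith
    have h1 : (j + 1) * T / m ∈ Set.Icc 0 T := by
      refine ⟨by positivity, ?_⟩
      rw [div_le_iff₀ hm', mul_comm T]
      gcongr
    have h2 : j * T / m ∈ Set.Icc 0 T := by
      refine ⟨by positivity, ?_⟩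
      rw [div_le_iff₀ hm', mul_comm T]
      gcongr
      exact (Finset.mem_range.mp hj).le
    exact ((hWm _ h1).sub (hWm _ h2)).const_smul (h (j * T / m))
  have hMlim : TendstoInMeasure P M atTop fun ω ↦ h T • X T ω := by
    refine tendstoInMeasure_of_tendsto_ae (fun m ↦ (hMm m).aestronglyMeasurable) ?_
    filter_upwards [hX.continuousOn] with ω hω
    have := (tendsto_sum_exp_integral_smul hT hgc hω (W := fun t ↦ W t ω) fun t ↦ rfl).const_add
      (X 0 ω)
    rwa [add_sub_cancel] at this
  have hMcf : ∀ m ≠ 0, ∀ t, charFun (P.map (M m)) t = charFun μ t *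
      Complex.exp (-((∑ j ∈ Finset.range m, h (j * T / m) ^ 2 *
        ∫ r in (j * T / m)..((j + 1) * T / m), β r) * ‖t‖ ^ 2 / 2 : ℝ)) := fun m hm t ↦ by
    have := charFun_map_add_sum_wienerIntegral hB hX0.aemeasurable hX.indep
      (by fun_prop) hT W hW (fun j ↦ h (j * T / m)) hm t
    rw [hX.hasLaw_zero.map_eq] at this
    simp only [Real.sq_sqrt (hβ0 _)] at this
    exact this
  have hcf : ∀ t, charFun (P.map fun ω ↦ h T • X T ω) t = charFun μ t *
      Complex.exp (-((σ ^ 2 * (h T ^ 2 - 1)) * ‖t‖ ^ 2 / 2 : ℝ)) := fun t ↦ by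
    refine tendsto_nhds_unique (tendsto_charFun_map_of_tendstoInMeasure hMm hMlim t) ?_
    have hv := tendsto_sum_mul_integral_uniformPartition hT
      (show Continuous fun r ↦ h r ^ 2 by fun_prop) hβ
    simp only [zero_add, sub_zero] at hv
    rw [integral_exp_integral_sq_mul hσ hβ] at hv
    have hcont : Continuous fun v : ℝ ↦
        charFun μ t * Complex.exp (-(v * ‖t‖ ^ 2 / 2 : ℝ)) := by fun_prop
    refine ((hcont.tendsto _).comp hv).congr' ?_
    filter_upwards [eventually_ne_atTop 0] with m hm
    exact (hMcf m hm t).symm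
  have := Measure.isProbabilityMeasure_map (μ := P) (hX.measurable T hTT).aemeasurable
  have hhT : h T ≠ 0 := (Real.exp_pos _).ne'
  have hinv : Real.exp (-∫ r in (0 : ℝ)..T, g r) = (h T)⁻¹ := Real.exp_neg _
  have h1T : 1 ≤ h T := by
    refine Real.one_le_exp (intervalIntegral.integral_nonneg hT fun r _ ↦ ?_)
    exact div_nonneg (hβ0 r) (by positivity)
  have hle : ((h T)⁻¹) ^ 2 ≤ 1 := pow_le_one₀ (by positivity) (inv_le_one_of_one_le₀ h1T)
  rw [hinv]
  refine Measure.ext_of_charFun (funext fun t ↦ ?_)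
  have h2 := hcf ((h T)⁻¹ • t)
  rw [charFun_map_smul_comp (hX.measurable T hTT).aemeasurable, smul_smul,
    mul_inv_cancel₀ hhT, one_smul] at h2
  rw [h2, charFun_ouLaw hle, norm_smul, mul_pow, Real.norm_eq_abs, sq_abs]
  congr 4
  field_simp

/-- The equation only involves the values of the schedule on `[0, T]`, so that a schedule continuous
on `[0, T]` may be replaced by a continuous extension. -/
theorem IsForwardProcess.congr {Ω : Type*} [MeasurableSpace Ω] {P : Measure Ω} {d : ℕ} {σ T : ℝ}
    {β β' : ℝ → ℝ} (hββ' : Set.EqOn β β' (Set.Icc 0 T)) {μ : Measure (EuclideanSpace ℝ (Fin d))}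
    {B : ℝ≥0 → Ω → EuclideanSpace ℝ (Fin d)} {X : ℝ → Ω → EuclideanSpace ℝ (Fin d)}
    (hX : IsForwardProcess P σ T β μ B X) : IsForwardProcess P σ T β' μ B X where
  __ := hX
  sde t ht := by
    have h := hX.sde t ht
    have h1 : wienerSum (fun s ↦ √(β s)) B t = wienerSum (fun s ↦ √(β' s)) B t := by
      ext1 n
      ext1 ω
      refine Finset.sum_congr rfl fun k hk ↦ ?_
      have hk := (Finset.mem_range.mp hk)
      have hn : (0 : ℝ) < n := by exact_mod_cast (Nat.zero_le k).trans_lt hk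
      have ht0 := ht.1
      beta_reduce
      rw [hββ' ⟨by positivity, ?_⟩]
      refine le_trans ?_ ht.2
      rw [div_le_iff₀ hn, mul_comm t]
      gcongr
    have h2 : ∀ ω, ∫ s in (0 : ℝ)..t, (β s / (2 * σ ^ 2)) • X s ω =
        ∫ s in (0 : ℝ)..t, (β' s / (2 * σ ^ 2)) • X s ω := fun ω ↦
      intervalIntegral.integral_congr fun s hs ↦ by
        rw [Set.uIcc_of_le ht.1] at hs
        simp only [hββ' ⟨hs.1, hs.2.trans ht.2⟩]
    unfold IsWienerIntegral at h ⊢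
    rw [← h1]
    simpa only [h2] using h

/-- At time `T` the forward process has the law of `a X_0 + √(1 - a²) Z`, where `a = exp (-∫₀ᵀ β /
(2σ²))`. -/
theorem IsForwardProcess.map_eq_ouLaw {Ω : Type*} [MeasurableSpace Ω] {P : Measure Ω}
    [IsProbabilityMeasure P] {d : ℕ} {σ T : ℝ} (hσ : 0 < σ) (hT : 0 ≤ T) {β : ℝ → ℝ}
    (hβ : ContinuousOn β (Set.Icc 0 T)) (hβ0 : ∀ t ∈ Set.Icc 0 T, 0 ≤ β t)
    {μ : Measure (EuclideanSpace ℝ (Fin d))} [IsProbabilityMeasure μ]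
    {B : ℝ≥0 → Ω → EuclideanSpace ℝ (Fin d)} {X : ℝ → Ω → EuclideanSpace ℝ (Fin d)}
    (hX : IsForwardProcess P σ T β μ B X) :
    P.map (X T) = ouLaw σ (Real.exp (-∫ r in (0 : ℝ)..T, β r / (2 * σ ^ 2))) μ := by
  set β' : ℝ → ℝ := Set.IccExtend hT ((Set.Icc 0 T).domRestrict β) with hβ'
  have hc : Continuous β' := (continuousOn_iff_continuous_domRestrict.mp hβ).Icc_extend'
  have heq : Set.EqOn β β' (Set.Icc 0 T) := fun t ht ↦ by
    rw [hβ', Set.IccExtend_of_mem _ _ ht]; rfl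
  rw [(hX.congr heq).map_eq_ouLaw_of_continuous hσ hT hc fun t ↦ hβ0 _ (Set.projIcc 0 T hT t).2]
  congr 3
  refine intervalIntegral.integral_congr fun r hr ↦ ?_
  rw [Set.uIcc_of_le hT] at hr
  simp only [heq hr]

theorem mainTheorem6 {Ω : Type*} [MeasurableSpace Ω] (P : Measure Ω) [IsProbabilityMeasure P]
    (d : ℕ) (σ T : ℝ) (hσ : 0 < σ) (hT : 0 < T)
    (β : ℝ → ℝ) (hβ : IsNoiseSchedule T β)
    (piData : Measure (EuclideanSpace ℝ (Fin d))) [IsProbabilityMeasure piData]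
    (B : ℝ≥0 → Ω → EuclideanSpace ℝ (Fin d)) (X : ℝ → Ω → EuclideanSpace ℝ (Fin d))
    (hX : IsForwardProcess P σ T β piData B X) :
    InformationTheory.klDiv (P.map (X T)) (piInf d σ) ≤
      InformationTheory.klDiv piData (piInf d σ) *
        ENNReal.ofReal (Real.exp (-(1 / σ ^ 2) * ∫ s in (0 : ℝ)..T, β s)) := by
  have hβ0 : ∀ t ∈ Set.Icc 0 T, 0 ≤ β t := fun t ht ↦ (hβ.pos t ht).le
  have hle : Real.exp (-∫ r in (0 : ℝ)..T, β r / (2 * σ ^ 2)) ≤ 1 := by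
    rw [Real.exp_le_one_iff, neg_nonpos]
    exact intervalIntegral.integral_nonneg hT.le fun r hr ↦ div_nonneg (hβ0 r hr) (by positivity)
  have h := klDiv_ouLaw_le_sq_mul (σ := σ) (Real.exp_pos _).le hle piData
  rw [hX.map_eq_ouLaw hσ hT.le hβ.continuousOn hβ0, mul_comm (klDiv piData _)]
  convert h using 3
  rw [intervalIntegral.integral_div, ← Real.exp_nat_mul]
  congr 1
  push_cast
  field_simp
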